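/- Let $d,p\ge 1$ be integers, $n=p^d$, and let $x_{\mathbf i}=(i_1/p,\dots,i_d/p)$, $\mathbf i\in\{1,\dots,p\}^d$, be the $n$ evenly spaced design points in $[0,1]^d$. For $\beta,L>0$ put $\ell=\lfloor\beta\rfloor$ and let $\Lambda(\beta,L)$ be the class of all $\ell$ times continuously differentiable functions $f:[0,1]^d\to\mathbb R$ with $$\sum_{j=0}^{\ell}\ \sum_{|\alpha|=j}\bigl|\partial^{\alpha}f(x)\bigr|+\sum_{|\alpha|=\ell}\frac{|\partial^{\alpha}f(x)-\partial^{\alpha}f(x')|}{\|x-x'\|_\infty^{\beta-\ell}}\le L\qquad\text{for all } x\ne x'\in[0,1]^d .$$ In Huber's $\epsilon$-contamination model with regression function $f$ and contamination $Q=(Q_{\mathbf i})$, where each $Q_{\mathbf i}$ is an arbitrary probability distribution on $\mathbb R$, one observes independent $y_{\mathbf i}\sim(1-\epsilon)N(f(x_{\mathbf i}),1)+\epsilon\,Q_{\mathbf i}$; write $\Pr_{f,\epsilon,Q}$ for the law of the data. An estimator is a measurable map that assigns to the data $y$ a function $\hat f=\hat f(y):[0,1]^d\to\mathbb R$, and $\|\hat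 f-f\|_2^2=\int_{[0,1]^d}|\hat f(x)-f(x)|^2\,dx\in[0,\infty]$. **Theorem.** For every $L_0>0$ there is a constant $C=C(L_0)>0$, depending on $L_0$ only, and for all $d\ge 1$, $\beta>0$ there is a non-zero polynomial $\wp=\wp_{d,\beta}$ with real coefficients, depending on $d$ and $\beta$ only and positive on $(0,\infty)$, such that for all $L_0>0$, $L\ge L_0$, $\epsilon\in(0,1)$, $n=p^d$ with $p\geq 1$, and every estimator $\hat f$ there exist $f\in\Lambda(\beta,L)$ and a contamination $Q$ with $$\Pr_{f,\epsilon,Q}\Bigl[\|\hat f-f\|_2^2\ \ge\ C\bigl(\wp(L)\,n^{-\frac{2\beta}{2\beta+d}}+\epsilon^2\bigr)\Bigr]\ \ge\ \frac14 .$$ -/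

import Mathlib

open MeasureTheory ProbabilityTheory

/-- The unit cube `[0,1]^d`.  The type `Fin d → ℝ` carries the sup norm. -/
def unitCube (d : ℕ) : Set (Fin d → ℝ) := Set.Icc 0 1

/-- The partial derivative `∂g/∂x_i` of a function on the closed cube (one-sided on the faces). -/
noncomputable def cubePartial {d : ℕ} (i : Fin d) (g : (Fin d → ℝ) → ℝ) :
    (Fin d → ℝ) → ℝ :=
  fun x => derivWithin (fun t : ℝ => g (Function.update x i t)) (Set.Icc 0 1) (x i)

/-- The mixed partial derivative `∂^|α| g / ∂x_1^{α_1} ⋯ ∂x_d^{α_d}` on the closed cube. -/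
noncomputable def cubeMixedPartial {d : ℕ} (α : Fin d → ℕ) (g : (Fin d → ℝ) → ℝ) :
    (Fin d → ℝ) → ℝ :=
  (List.finRange d).foldr (fun i h => (cubePartial i)^[α i] h) g

/-- The Hölder class `Λ(β, L)` on `[0,1]^d`: with `ℓ = ⌊β⌋`, the function is `ℓ` times continuously
differentiable on the cube, and for all `x, x'` in the cube the sum of the absolute values of all
partial derivatives at `x` of orders `0, …, ℓ`, plus the sum over the multi-indices of order `ℓ` of
the `(β - ℓ)`-Hölder quotients (sup norm), is at most `L`.
Only the values of `f` on the cube matter. -/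
def HolderClass (d : ℕ) (β L : ℝ) (f : (Fin d → ℝ) → ℝ) : Prop :=
  ContDiffOn ℝ (⌊β⌋₊ : ℕ) f (unitCube d) ∧
  ∀ x ∈ unitCube d, ∀ x' ∈ unitCube d,
    ∑ j ∈ Finset.range (⌊β⌋₊ + 1),
        ∑ α ∈ Finset.piAntidiag (Finset.univ : Finset (Fin d)) j, |cubeMixedPartial α f x|
      + ∑ α ∈ Finset.piAntidiag (Finset.univ : Finset (Fin d)) ⌊β⌋₊,
          |cubeMixedPartial α f x - cubeMixedPartial α f x'| / ‖x - x'‖ ^ (β - (⌊β⌋₊ : ℝ))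
      ≤ L

/-- The design point `(i_1/p, …, i_d/p)`, `i_k = 1, …, p` (here `Fin p` counts from `0`). -/
noncomputable def designPoint {d p : ℕ} (i : Fin d → Fin p) : Fin d → ℝ :=
  fun k => (((i k : ℕ) : ℝ) + 1) / (p : ℝ)

/-- The law of the data `(y_i)` of the `n = p^d` observations in Huber's contamination model:
the `y_i` are independent with `y_i ∼ (1 - ε) N(f(x_i), 1) + ε Q_i`. -/
noncomputable def huberLaw {d p : ℕ} (f : (Fin d → ℝ) → ℝ) (ε : ℝ)
    (Q : (Fin d → Fin p) → ProbabilityMeasure ℝ) : Measure ((Fin d → Fin p) → ℝ) :=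
  Measure.pi fun i =>
    ENNReal.ofReal (1 - ε) • gaussianReal (f (designPoint i)) 1
      + ENNReal.ofReal ε • (Q i : Measure ℝ)

/-- The squared `L²([0,1]^d)` distance, as an extended nonnegative number. -/
noncomputable def cubeSqDist {d : ℕ} (g f : (Fin d → ℝ) → ℝ) : ENNReal :=
  ∫⁻ x in unitCube d, ENNReal.ofReal (|g x - f x| ^ 2)

/-! The two terms of the rate come from two separate obstructions. Each already arises in the class
of radius `lam = min 1 L₀`, which lies in `Λ(β, L)`. The larger of two lower bounds is at least half
their sum, so it suffices to use the obstruction that dominates.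

Contamination. The constants `0` and `a = lam * ε / 2` give Gaussian laws at total variation at most
`ε`. Suitable contaminations then make the two data laws identical (`exists_contamination_eq`). No
estimator can be within `a / 2` of both constants, so it errs with probability at least one half
under one of them (`exists_const_of_contamination`).

Smoothness. Cut the cube into `m ^ d` cells with `m` of order `n ^ (1 / (2β + d))`, and on each cell
switch on or off a bump of height `τ`, of order `lam * m ^ (-β)`. Such sums stay in the Hölder ball
(`exists_holderClass_bumpSum`). Because `n * τ ^ 2` is small compared with `m ^ d`, flipping one bit
changes the Gaussian data law little on average. Assouad's argument (`exists_assouad`) then forces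
errors of order `τ ^ 2` on a fixed fraction of the cells. Here each contamination is the Gaussian
itself, so it has no effect.

All dependence on `d` and `β` is absorbed in the polynomial, which can be taken constant. -/

/-! ### Gaussian likelihood ratios and total variation -/

/-- The likelihood ratio of `N(b, 1)` with respect to `N(a, 1)`. -/
noncomputable def gaussianRatio (a b y : ℝ) : ℝ :=
  Real.exp ((b - a) * (y - a) - (b - a) ^ 2 / 2)

theorem measurable_gaussianRatio (a b : ℝ) : Measurable (gaussianRatio a b) := by
  unfold gaussianRatio; fun_prop

theorem gaussianRatio_pos (a b y : ℝ) : 0 < gaussianRatio a b y := Real.exp_pos _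

theorem gaussianReal_eq_withDensity_gaussianRatio (a b : ℝ) :
    gaussianReal b 1
      = (gaussianReal a 1).withDensity fun y => ENNReal.ofReal (gaussianRatio a b y) := by
  rw [gaussianReal_of_var_ne_zero _ one_ne_zero, gaussianReal_of_var_ne_zero _ one_ne_zero,
    ← withDensity_mul _ (measurable_gaussianPDF a 1)
      (measurable_gaussianRatio a b).ennreal_ofReal]
  congr 1
  ext y
  simp only [Pi.mul_apply, gaussianPDF, gaussianPDFReal, gaussianRatio]
  rw [← ENNReal.ofReal_mul (by positivity), mul_assoc (_⁻¹), ← Real.exp_add]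
  congr 3
  simp only [NNReal.coe_one]
  ring

theorem integrable_gaussianRatio (a b : ℝ) :
    Integrable (gaussianRatio a b) (gaussianReal a 1) := by
  have h := (integrable_exp_mul_gaussianReal (μ := a) (v := 1) (b - a)).mul_const
    (Real.exp (-(b - a) * a - (b - a) ^ 2 / 2))
  refine h.congr (Filter.Eventually.of_forall fun y => ?_)
  simp only [gaussianRatio]
  rw [← Real.exp_add]
  congr 1; ring

theorem gaussianRatio_sq (a b y : ℝ) : gaussianRatio a b y ^ 2
    = Real.exp (2 * (b - a) * y) * Real.exp (-2 * (b - a) * a - (b - a) ^ 2) := by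
  rw [gaussianRatio, ← Real.exp_nat_mul, ← Real.exp_add]
  congr 1; push_cast; ring

theorem integrable_gaussianRatio_sq (a b : ℝ) :
    Integrable (fun y => gaussianRatio a b y ^ 2) (gaussianReal a 1) := by
  simp only [gaussianRatio_sq]
  exact (integrable_exp_mul_gaussianReal _).mul_const _

theorem integral_gaussianRatio_sq (a b : ℝ) :
    ∫ y, gaussianRatio a b y ^ 2 ∂(gaussianReal a 1) = Real.exp ((b - a) ^ 2) := by
  simp only [gaussianRatio_sq]
  have h := mgf_gaussianReal (p := gaussianReal a 1) (X := id) (μ := a) (v := 1)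
    (by simp) (2 * (b - a))
  simp only [mgf, id] at h
  rw [integral_mul_const, h, ← Real.exp_add]
  congr 1; simp; ring

/-- A product of measures with densities has the product density. -/
theorem pi_withDensity_ofReal {ι : Type*} [Fintype ι] (μ : ι → Measure ℝ)
    [∀ i, IsProbabilityMeasure (μ i)] (g : ι → ℝ → ℝ) (hg : ∀ i y, 0 ≤ g i y)
    (hgi : ∀ i, Integrable (g i) (μ i))
    (ν : ι → Measure ℝ) [∀ i, IsProbabilityMeasure (ν i)]
    (hν : ∀ i, ν i = (μ i).withDensity fun y => ENNReal.ofReal (g i y)) :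
    Measure.pi ν = (Measure.pi μ).withDensity fun y => ENNReal.ofReal (∏ i, g i (y i)) := by
  refine Measure.pi_eq fun s hs => ?_
  rw [withDensity_apply _ (MeasurableSet.univ_pi hs), Measure.restrict_pi_pi,
    ← ofReal_integral_eq_lintegral_ofReal
      (Integrable.fintype_prod fun i => (hgi i).restrict)
      (Filter.Eventually.of_forall fun y => Finset.prod_nonneg fun i _ => hg i _),
    integral_fintype_prod_eq_prod,
    ENNReal.ofReal_prod_of_nonneg fun i _ => integral_nonneg (hg i)]
  refine Finset.prod_congr rfl fun i _ => ?_
  rw [hν i, withDensity_apply _ (hs i), ofReal_integral_eq_lintegral_ofReal (hgi i).restrict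
    (Filter.Eventually.of_forall (hg i))]

/-- A bound on the total variation distance by the second moment of the density. -/
theorem abs_measureReal_sub_le_of_density {Ω : Type*} [MeasurableSpace Ω] (μ ν : Measure Ω)
    [IsProbabilityMeasure μ] [IsProbabilityMeasure ν] (g : Ω → ℝ) (hg : ∀ y, 0 ≤ g y)
    (hgi : Integrable g μ) (hg2 : Integrable (fun y => g y ^ 2) μ)
    (hν : ν = μ.withDensity fun y => ENNReal.ofReal (g y)) {v : ℝ} (hv0 : 0 ≤ v)
    (hv : v ≤ 1 / 2) (hgv : ∫ y, g y ^ 2 ∂μ = Real.exp v) {t : ℝ} (ht : 0 < t)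
    {A : Set Ω} (hA : MeasurableSet A) :
    |ν.real A - μ.real A| ≤ t / 2 + v / t := by
  have hreal : ∀ B, MeasurableSet B → ν.real B = ∫ y in B, g y ∂μ := by
    intro B hB
    rw [Measure.real, hν, withDensity_apply _ hB, ← ofReal_integral_eq_lintegral_ofReal
      hgi.restrict (Filter.Eventually.of_forall hg),
      ENNReal.toReal_ofReal (integral_nonneg hg)]
  have hone : ∫ y, g y ∂μ = 1 := by
    have h := hreal Set.univ MeasurableSet.univ
    rw [setIntegral_univ] at h
    rw [← h]; simp
  -- From `exp v ≤ 1 / (1 - v)`; the bound by `1 + 2 * v` is where `v ≤ 1 / 2` enters.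
  have hexp : Real.exp v ≤ 1 + 2 * v := by
    have h1 : Real.exp v * (1 - v) ≤ 1 := by
      have h2 := Real.add_one_le_exp (-v)
      calc Real.exp v * (1 - v) ≤ Real.exp v * Real.exp (-v) := by
            gcongr; linarith
        _ = 1 := by rw [← Real.exp_add]; simp
    have h2 : 0 < 1 - v := by linarith
    have h3 : Real.exp v ≤ 1 / (1 - v) := by rwa [le_div_iff₀ h2]
    refine h3.trans ?_
    rw [div_le_iff₀ h2]
    nlinarith
  have hsq : ∫ y, (g y - 1) ^ 2 ∂μ = Real.exp v - 1 := by
    have h1 : ∀ y, (g y - 1) ^ 2 = g y ^ 2 - (2 * g y - 1) := fun y => by ring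
    have h2 : Integrable (fun y => 2 * g y - 1) μ := (hgi.const_mul 2).sub (integrable_const 1)
    simp only [h1]
    rw [integral_sub hg2 h2, integral_sub (hgi.const_mul 2) (integrable_const 1),
      integral_const_mul, hone, hgv]
    simp; ring
  have hsqi : Integrable (fun y => (g y - 1) ^ 2) μ := by
    have h1 : ∀ y, (g y - 1) ^ 2 = g y ^ 2 - (2 * g y - 1) := fun y => by ring
    simp only [h1]
    exact hg2.sub ((hgi.const_mul 2).sub (integrable_const 1))
  have hi : Integrable (fun y => g y - 1) μ := hgi.sub (integrable_const 1)
  have hdiff : ν.real A - μ.real A = ∫ y in A, (g y - 1) ∂μ := by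
    rw [hreal A hA, integral_sub hgi.restrict (integrable_const 1)]
    simp
  calc |ν.real A - μ.real A| ≤ ∫ y in A, |g y - 1| ∂μ := by
        rw [hdiff]; exact abs_integral_le_integral_abs
    _ ≤ ∫ y, |g y - 1| ∂μ :=
        setIntegral_le_integral hi.abs (Filter.Eventually.of_forall fun y => abs_nonneg _)
    _ ≤ ∫ y, (t / 2 + (g y - 1) ^ 2 * (1 / (2 * t))) ∂μ := by
        refine integral_mono hi.abs ((integrable_const _).add (hsqi.mul_const _)) fun y => ?_
        -- AM-GM with free weight `t`, which replaces Cauchy–Schwarz and avoids square roots.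
        have h1 : t / 2 + (g y - 1) ^ 2 * (1 / (2 * t)) - |g y - 1|
            = (|g y - 1| - t) ^ 2 / (2 * t) := by
          rw [← sq_abs (g y - 1)]; field_simp; ring
        have h2 : 0 ≤ (|g y - 1| - t) ^ 2 / (2 * t) := by positivity
        simp only; linarith
    _ = t / 2 + (Real.exp v - 1) * (1 / (2 * t)) := by
        rw [integral_add (integrable_const _) (hsqi.mul_const _), integral_mul_const, hsq]
        simp
    _ ≤ t / 2 + (2 * v) * (1 / (2 * t)) := by gcongr; linarith
    _ = t / 2 + v / t := by field_simp

/-- The second moment of a product density is the product of second moments, here the exponential of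
the squared distance between the mean vectors. The weight `t = 1 / 10` leaves a constant `1 / 20`,
small enough for Assouad's lemma. -/
theorem abs_pi_gaussianReal_sub_le {ι : Type*} [Fintype ι] (a b : ι → ℝ)
    {A : Set (ι → ℝ)} (hA : MeasurableSet A) :
    |(Measure.pi fun i => gaussianReal (b i) 1).real A
      - (Measure.pi fun i => gaussianReal (a i) 1).real A|
      ≤ 1 / 20 + 10 * ∑ i, (b i - a i) ^ 2 := by
  set v := ∑ i, (b i - a i) ^ 2 with hv
  have hv0 : 0 ≤ v := Finset.sum_nonneg fun i _ => sq_nonneg _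
  rcases le_or_gt v (1 / 2) with h | h
  · have := abs_measureReal_sub_le_of_density (Measure.pi fun i => gaussianReal (a i) 1)
      (Measure.pi fun i => gaussianReal (b i) 1) (fun y => ∏ i, gaussianRatio (a i) (b i) (y i))
      (fun y => Finset.prod_nonneg fun i _ => (gaussianRatio_pos _ _ _).le)
      (Integrable.fintype_prod fun i => integrable_gaussianRatio _ _)
      (by
        simp only [← Finset.prod_pow]
        exact Integrable.fintype_prod (f := fun i y => gaussianRatio (a i) (b i) y ^ 2)
          fun i => integrable_gaussianRatio_sq _ _)
      (pi_withDensity_ofReal _ (fun i => gaussianRatio (a i) (b i))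
        (fun i y => (gaussianRatio_pos _ _ _).le) (fun i => integrable_gaussianRatio _ _) _
        fun i => gaussianReal_eq_withDensity_gaussianRatio _ _)
      hv0 h
      (by
        simp only [← Finset.prod_pow]
        rw [integral_fintype_prod_eq_prod (f := fun i y => gaussianRatio (a i) (b i) y ^ 2),
          hv, Real.exp_sum]
        exact Finset.prod_congr rfl fun i _ => integral_gaussianRatio_sq _ _)
      (t := 1 / 10) (by norm_num) hA
    linarith
  -- For `v > 1 / 2` the right side exceeds `5`, while probabilities differ by at most `1`.
  · have h1 := measureReal_le_one (μ := Measure.pi fun i => gaussianReal (a i) 1) (s := A)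
    have h2 := measureReal_le_one (μ := Measure.pi fun i => gaussianReal (b i) 1) (s := A)
    have h3 := measureReal_nonneg (μ := Measure.pi fun i => gaussianReal (a i) 1) (s := A)
    have h4 := measureReal_nonneg (μ := Measure.pi fun i => gaussianReal (b i) 1) (s := A)
    rw [abs_le]
    constructor <;> linarith

theorem abs_gaussianReal_sub_le {a ε : ℝ} (hε : 0 < ε) (hε1 : ε < 1) (ha : |a| ≤ ε / 2)
    {A : Set ℝ} (hA : MeasurableSet A) :
    |(gaussianReal a 1).real A - (gaussianReal 0 1).real A| ≤ ε := by
  have ha2 : a ^ 2 ≤ (ε / 2) ^ 2 := by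
    rw [← sq_abs a]; gcongr
  have := abs_measureReal_sub_le_of_density (gaussianReal 0 1) (gaussianReal a 1)
    (gaussianRatio 0 a) (fun y => (gaussianRatio_pos _ _ _).le) (integrable_gaussianRatio _ _)
    (integrable_gaussianRatio_sq _ _) (gaussianReal_eq_withDensity_gaussianRatio _ _)
    (v := a ^ 2) (sq_nonneg _) (by nlinarith) (by simpa using integral_gaussianRatio_sq 0 a)
    (t := ε / 2) (by linarith) hA
  refine this.trans ?_
  have : a ^ 2 / (ε / 2) ≤ ε / 2 := by
    rw [div_le_iff₀ (by linarith)]; nlinarith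
  linarith

/-! ### Matching two laws by contamination -/

/-- Two laws at total variation distance at most `ε` can be made equal by an
`ε`-contamination. -/
theorem exists_contamination_eq {Ω : Type*} [MeasurableSpace Ω] [Inhabited Ω] (μ ν : Measure Ω)
    [IsProbabilityMeasure μ] [IsProbabilityMeasure ν] {ε : ℝ} (hε : 0 < ε) (hε1 : ε < 1)
    (h : ∀ A, MeasurableSet A → |ν.real A - μ.real A| ≤ ε) :
    ∃ Q R : ProbabilityMeasure Ω,
      ENNReal.ofReal (1 - ε) • μ + ENNReal.ofReal ε • (Q : Measure Ω)
        = ENNReal.ofReal (1 - ε) • ν + ENNReal.ofReal ε • (R : Measure Ω) := by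
  obtain ⟨s, hs, h1, h2⟩ := hahn_decomposition μ ν
  -- `ρ` is the least upper bound of `μ` and `ν`. Both contaminated laws are to equal `(1 - ε) • ρ`,
  -- completed to mass one by an atom of mass `w`.
  set ρ : Measure Ω := μ.restrict s + ν.restrict sᶜ with hρ
  have hμρ : μ ≤ ρ := by
    refine Measure.le_iff.2 fun t ht => ?_
    rw [hρ, Measure.add_apply, Measure.restrict_apply ht, Measure.restrict_apply ht,
      ← measure_inter_add_sdiff (μ := μ) t hs]
    exact add_le_add le_rfl (h2 _ (ht.inter hs.compl) Set.inter_subset_right)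
  have hνρ : ν ≤ ρ := by
    refine Measure.le_iff.2 fun t ht => ?_
    rw [hρ, Measure.add_apply, Measure.restrict_apply ht, Measure.restrict_apply ht,
      ← measure_inter_add_sdiff (μ := ν) t hs]
    exact add_le_add (h1 _ (ht.inter hs) Set.inter_subset_right) le_rfl
  have hmass : ρ.real Set.univ ≤ 1 + ε := by
    have e : ρ.real Set.univ = μ.real s + ν.real sᶜ := by
      rw [hρ, measureReal_add_apply]; simp
    rw [e, probReal_compl_eq_one_sub hs]
    have := (abs_le.1 (h s hs)).1
    linarith
  -- Since `ρ` has mass at most `1 + ε`, the missing mass satisfies `w ≥ ε ^ 2`.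
  set w : ℝ := 1 - (1 - ε) * ρ.real Set.univ with hw
  have hw0 : 0 ≤ w := by
    have : (1 - ε) * ρ.real Set.univ ≤ (1 - ε) * (1 + ε) := by gcongr
    nlinarith
  have key : ∀ κ : Measure Ω, IsProbabilityMeasure κ → κ ≤ ρ → ∃ Q : ProbabilityMeasure Ω,
      ENNReal.ofReal (1 - ε) • κ + ENNReal.ofReal ε • (Q : Measure Ω)
        = ENNReal.ofReal (1 - ε) • ρ + ENNReal.ofReal w • Measure.dirac default := by
    intro κ hκ hle
    set T : Measure Ω := ENNReal.ofReal (1 - ε) • (ρ - κ)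
      + ENNReal.ofReal w • Measure.dirac default with hT
    have hsub : ρ - κ + κ = ρ := Measure.sub_add_cancel_of_le hle
    have hTm : T Set.univ = ENNReal.ofReal ε := by
      have e1 : (ρ - κ).real Set.univ = ρ.real Set.univ - 1 := by
        have : (ρ - κ + κ).real Set.univ = ρ.real Set.univ := by rw [hsub]
        rw [measureReal_add_apply] at this
        simp at this
        linarith
      have i1 := Measure.smul_finite (ρ - κ) (c := ENNReal.ofReal (1 - ε)) ENNReal.ofReal_ne_top
      have i2 := Measure.smul_finite (Measure.dirac (default : Ω)) (c := ENNReal.ofReal w)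
        ENNReal.ofReal_ne_top
      have i3 : IsFiniteMeasure T := by rw [hT]; infer_instance
      rw [← ENNReal.ofReal_toReal (measure_ne_top T Set.univ)]
      congr 1
      change T.real Set.univ = ε
      rw [hT, measureReal_add_apply, measureReal_ennreal_smul_apply, e1,
        measureReal_ennreal_smul_apply, ENNReal.toReal_ofReal (by linarith),
        ENNReal.toReal_ofReal hw0]
      simp only [hw, probReal_univ]
      ring
    have hε' : ENNReal.ofReal ε ≠ 0 := by simpa using hε
    refine ⟨⟨(ENNReal.ofReal ε)⁻¹ • T, ⟨?_⟩⟩, ?_⟩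
    · rw [Measure.smul_apply, hTm, smul_eq_mul, ENNReal.inv_mul_cancel hε' ENNReal.ofReal_ne_top]
    · rw [ProbabilityMeasure.coe_mk, smul_smul,
        ENNReal.mul_inv_cancel hε' ENNReal.ofReal_ne_top, one_smul, hT, ← add_assoc,
        ← smul_add, add_comm κ, hsub]
  obtain ⟨Q, hQ⟩ := key μ inferInstance hμρ
  obtain ⟨R, hR⟩ := key ν inferInstance hνρ
  exact ⟨Q, R, hQ.trans hR.symm⟩

/-! ### Separation of two constants -/

/-- For every `g`, one of `0` and `a` is at squared distance at least `a² / 4 · vol B`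
from `g` on `B`. -/
theorem lintegral_sq_sub_const_ge {d : ℕ} (B : Set (Fin d → ℝ)) (a : ℝ)
    (g : (Fin d → ℝ) → ℝ) (hg : Measurable g) :
    ENNReal.ofReal (a ^ 2 / 4) * volume B ≤ ∫⁻ x in B, ENNReal.ofReal (|g x - 0| ^ 2) ∨
      ENNReal.ofReal (a ^ 2 / 4) * volume B ≤ ∫⁻ x in B, ENNReal.ofReal (|g x - a| ^ 2) := by
  by_contra! hcon
  have h1 : ENNReal.ofReal (a ^ 2 / 2) * volume B
      ≤ ∫⁻ x in B, (ENNReal.ofReal (|g x - 0| ^ 2) + ENNReal.ofReal (|g x - a| ^ 2)) := by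
    rw [← setLIntegral_const]
    refine lintegral_mono fun x => ?_
    rw [← ENNReal.ofReal_add (by positivity) (by positivity)]
    refine ENNReal.ofReal_le_ofReal ?_
    rw [sq_abs, sq_abs]
    nlinarith [sq_nonneg (2 * g x - a)]
  rw [lintegral_add_left (by fun_prop)] at h1
  have h2 := ENNReal.add_lt_add hcon.1 hcon.2
  rw [← add_mul, ← ENNReal.ofReal_add (by positivity) (by positivity)] at h2
  have h3 : a ^ 2 / 4 + a ^ 2 / 4 = a ^ 2 / 2 := by ring
  rw [h3] at h2
  exact absurd h1 (not_le.2 h2)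

/-! ### Tensor bumps and their derivatives -/

/-- A smooth bump equal to `1` on `[3/8, 5/8]` and supported in `[1/4, 3/4]`. -/
noncomputable def unitBump : ContDiffBump (1 / 2 : ℝ) where
  rIn := 1 / 8
  rOut := 1 / 4
  rIn_pos := by norm_num
  rIn_lt_rOut := by norm_num

/-- The mixed partial derivative of order `s` of the tensor product of unit bumps. -/
noncomputable def tensorBump {d : ℕ} (s : Fin d → ℕ) (u : Fin d → ℝ) : ℝ :=
  ∏ j, iteratedDeriv (s j) unitBump (u j)

/-- The combination with coefficients `c` of the tensor bumps on the cells of side `1/m`. -/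
noncomputable def bumpSum {d : ℕ} (m : ℕ) (c : (Fin d → Fin m) → ℝ) (s : Fin d → ℕ)
    (x : Fin d → ℝ) : ℝ :=
  ∑ k, c k * tensorBump s (fun j => m * x j - (k j : ℕ))

theorem contDiff_iteratedDeriv_unitBump (n : ℕ) {r : ℕ∞} :
    ContDiff ℝ r (iteratedDeriv n unitBump) := by
  rw [iteratedDeriv_eq_iterate]
  exact (ContDiff.iterate_deriv n unitBump.contDiff).of_le (by exact_mod_cast le_top)

theorem mem_Icc_of_iteratedDeriv_unitBump_ne_zero {n : ℕ} {t : ℝ}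
    (h : iteratedDeriv n unitBump t ≠ 0) : t ∈ Set.Icc (1 / 4 : ℝ) (3 / 4) := by
  have h1 : tsupport (iteratedDeriv n unitBump) ⊆ tsupport unitBump := by
    clear h
    induction n with
    | zero => simp
    | succ n ih =>
      rw [iteratedDeriv_succ]
      exact (tsupport_deriv_subset (𝕜 := ℝ)).trans ih
  have h2 := h1 (subset_tsupport _ h)
  rw [unitBump.tsupport_eq, Real.closedBall_eq_Icc] at h2
  simp only [unitBump] at h2
  norm_num at h2
  norm_num
  exact h2

theorem contDiff_tensorBump {d : ℕ} (s : Fin d → ℕ) {r : ℕ∞} :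
    ContDiff ℝ r (tensorBump s) := by
  unfold tensorBump
  exact contDiff_prod fun j _ => (contDiff_iteratedDeriv_unitBump (s j)).comp (contDiff_apply ℝ ℝ j)

theorem mem_Icc_of_tensorBump_ne_zero {d : ℕ} {s : Fin d → ℕ} {u : Fin d → ℝ}
    (h : tensorBump s u ≠ 0) (j : Fin d) : u j ∈ Set.Icc (1 / 4 : ℝ) (3 / 4) :=
  mem_Icc_of_iteratedDeriv_unitBump_ne_zero (Finset.prod_ne_zero_iff.1 h j (Finset.mem_univ j))

theorem hasCompactSupport_tensorBump {d : ℕ} (s : Fin d → ℕ) :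
    HasCompactSupport (tensorBump s) := by
  refine HasCompactSupport.intro (K := Set.Icc (fun _ => 1 / 4) (fun _ => 3 / 4)) isCompact_Icc
    fun u hu => ?_
  by_contra h
  exact hu ⟨fun j => (mem_Icc_of_tensorBump_ne_zero h j).1,
    fun j => (mem_Icc_of_tensorBump_ne_zero h j).2⟩

theorem exists_tensorBump_bound {d : ℕ} (s : Fin d → ℕ) :
    ∃ K : ℝ, 0 ≤ K ∧ (∀ u, |tensorBump s u| ≤ K) ∧
      ∀ u v, |tensorBump s u - tensorBump s v| ≤ K * ‖u - v‖ := by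
  have hc : ContDiff ℝ 1 (tensorBump s) := contDiff_tensorBump s (r := 1)
  obtain ⟨K₁, h₁⟩ := hc.lipschitzWith_of_hasCompactSupport (hasCompactSupport_tensorBump s)
    one_ne_zero
  obtain ⟨K₂, h₂⟩ := (hasCompactSupport_tensorBump s).exists_bound_of_continuous hc.continuous
  have h0 : 0 ≤ K₂ := (norm_nonneg _).trans (h₂ 0)
  refine ⟨K₁ + K₂, by positivity, fun u => ?_, fun u v => ?_⟩
  · have := h₂ u
    rw [Real.norm_eq_abs] at this
    have : (0 : ℝ) ≤ K₁ := K₁.2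
    linarith
  · have := h₁.dist_le_mul u v
    rw [Real.dist_eq, dist_eq_norm] at this
    have : 0 ≤ K₂ * ‖u - v‖ := by positivity
    linarith

/-- For distances below `1` the Lipschitz bound is stronger than the Hölder one; above `1` the sup
bound suffices. Hence one constant serves every exponent in `[0, 1]`. -/
theorem exists_tensorBump_holder {d : ℕ} (s : Fin d → ℕ) :
    ∃ K : ℝ, 0 ≤ K ∧ (∀ u, |tensorBump s u| ≤ K) ∧
      ∀ γ : ℝ, 0 ≤ γ → γ ≤ 1 → ∀ u v, |tensorBump s u - tensorBump s v| ≤ 2 * K * ‖u - v‖ ^ γ := by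
  obtain ⟨K, hK, h1, h2⟩ := exists_tensorBump_bound s
  refine ⟨K, hK, h1, fun γ h0 hγ u v => ?_⟩
  rcases le_total ‖u - v‖ 1 with h | h
  · have h3 : ‖u - v‖ ≤ ‖u - v‖ ^ γ := by
      rcases (norm_nonneg (u - v)).eq_or_lt with h4 | h4
      · rw [← h4]; positivity
      · simpa using Real.rpow_le_rpow_of_exponent_ge h4 h hγ
    have h4 := h2 u v
    have h5 : K * ‖u - v‖ ≤ K * ‖u - v‖ ^ γ := by gcongr
    have h6 : 0 ≤ K * ‖u - v‖ ^ γ := by positivity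
    linarith
  · have h3 : 1 ≤ ‖u - v‖ ^ γ := Real.one_le_rpow h h0
    have h4 := abs_sub (tensorBump s u) (tensorBump s v)
    have h5 : 2 * K * 1 ≤ 2 * K * ‖u - v‖ ^ γ := by gcongr
    linarith [h1 u, h1 v]

-- Supports lie in the middle halves of the cells, so bumps of distinct cells never meet. This makes
-- all later bounds independent of the number of cells.
open Classical in
theorem card_tensorBump_ne_zero_le_one {d : ℕ} (m : ℕ) (s : Fin d → ℕ) (x : Fin d → ℝ) :
    (Finset.univ.filter fun k : Fin d → Fin m =>
      tensorBump s (fun j => m * x j - (k j : ℕ)) ≠ 0).card ≤ 1 := by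
  refine Finset.card_le_one.2 fun k hk k' hk' => funext fun j => Fin.ext ?_
  rw [Finset.mem_filter] at hk hk'
  have h1 := mem_Icc_of_tensorBump_ne_zero hk.2 j
  have h2 := mem_Icc_of_tensorBump_ne_zero hk'.2 j
  rw [Set.mem_Icc] at h1 h2
  have h3 : ((k j : ℕ) : ℝ) < ((k' j : ℕ) : ℝ) + 1 := by linarith
  have h4 : ((k' j : ℕ) : ℝ) < ((k j : ℕ) : ℝ) + 1 := by linarith
  norm_cast at h3 h4
  omega

/-- A sum whose terms are bounded by `D` and vanish outside of a set of at most `N` indices. -/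
theorem sum_le_of_card_support_le {ι : Type*} [Fintype ι] (f : ι → ℝ) (S : Finset ι) (N : ℕ)
    (hS : S.card ≤ N) (hf : ∀ i ∉ S, f i = 0) {D : ℝ} (hD : 0 ≤ D) (h : ∀ i, f i ≤ D) :
    ∑ i, f i ≤ N * D := by
  rw [← Finset.sum_subset (Finset.subset_univ S) fun i _ hi => hf i hi]
  calc ∑ i ∈ S, f i ≤ S.card • D := Finset.sum_le_card_nsmul _ _ _ fun i _ => h i
    _ ≤ N * D := by rw [nsmul_eq_mul]; gcongr

theorem abs_bumpSum_le {d m : ℕ} {c : (Fin d → Fin m) → ℝ} {τ K : ℝ} (hc : ∀ k, |c k| ≤ τ)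
    (hτ : 0 ≤ τ) (s : Fin d → ℕ) (hK : 0 ≤ K) (h : ∀ u, |tensorBump s u| ≤ K) (x : Fin d → ℝ) :
    |bumpSum m c s x| ≤ τ * K := by
  classical
  refine (Finset.abs_sum_le_sum_abs _ _).trans ?_
  have := sum_le_of_card_support_le
    (fun k : Fin d → Fin m => |c k * tensorBump s (fun j => m * x j - (k j : ℕ))|) _ 1
    (card_tensorBump_ne_zero_le_one m s x) (fun k hk => ?_) (D := τ * K) (by positivity)
    fun k => ?_
  · simpa using this
  · simp only [Finset.mem_filter, Finset.mem_univ, true_and, not_not] at hk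
    simp [hk]
  · rw [abs_mul]
    exact mul_le_mul (hc k) (h _) (abs_nonneg _) hτ

/-- At most two cells contribute, one for each point, which turns `2 * K` into `4 * K`; the
rescaling by `m` multiplies distances by `m`. -/
theorem abs_bumpSum_sub_le {d m : ℕ} {c : (Fin d → Fin m) → ℝ} {τ K γ : ℝ}
    (hc : ∀ k, |c k| ≤ τ) (hτ : 0 ≤ τ) (s : Fin d → ℕ) (hK : 0 ≤ K)
    (h : ∀ u v, |tensorBump s u - tensorBump s v| ≤ 2 * K * ‖u - v‖ ^ γ) (x x' : Fin d → ℝ) :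
    |bumpSum m c s x - bumpSum m c s x'| ≤ τ * (4 * K) * (m * ‖x - x'‖) ^ γ := by
  classical
  rw [bumpSum, bumpSum, ← Finset.sum_sub_distrib]
  refine (Finset.abs_sum_le_sum_abs _ _).trans ?_
  have := sum_le_of_card_support_le
    (fun k : Fin d → Fin m => |c k * tensorBump s (fun j => m * x j - (k j : ℕ))
      - c k * tensorBump s (fun j => m * x' j - (k j : ℕ))|) _ 2
    ((Finset.card_union_le _ _).trans (add_le_add (card_tensorBump_ne_zero_le_one m s x)
      (card_tensorBump_ne_zero_le_one m s x'))) (fun k hk => ?_)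
    (D := τ * (2 * K * (m * ‖x - x'‖) ^ γ)) (by positivity) fun k => ?_
  · refine this.trans (le_of_eq ?_)
    push_cast; ring
  · simp only [Finset.mem_union, Finset.mem_filter, Finset.mem_univ, true_and, not_or,
      not_not] at hk
    simp [hk.1, hk.2]
  · rw [← mul_sub, abs_mul]
    refine mul_le_mul (hc k) ?_ (abs_nonneg _) hτ
    have h1 := h (fun j => m * x j - (k j : ℕ)) (fun j => m * x' j - (k j : ℕ))
    have h2 : ((fun j => m * x j - (k j : ℕ)) - fun j => m * x' j - (k j : ℕ) : Fin d → ℝ)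
        = (m : ℝ) • (x - x') := by
      ext j; simp; ring
    rw [h2, norm_smul] at h1
    simpa using h1

theorem hasDerivAt_tensorBump_update {d : ℕ} (m : ℕ) (s : Fin d → ℕ) (x b : Fin d → ℝ)
    (i : Fin d) :
    HasDerivAt (fun t : ℝ => tensorBump s (fun j => m * Function.update x i t j - b j))
      (m * tensorBump (s + Pi.single i 1) (fun j => m * x j - b j)) (x i) := by
  have h1 : ∀ t : ℝ, tensorBump s (fun j => m * Function.update x i t j - b j)
      = iteratedDeriv (s i) unitBump (m * t - b i)
        * ∏ j ∈ Finset.univ.erase i, iteratedDeriv (s j) unitBump (m * x j - b j) := by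
    intro t
    rw [tensorBump, ← Finset.mul_prod_erase _ _ (Finset.mem_univ i)]
    congr 1
    · simp
    · refine Finset.prod_congr rfl fun j hj => ?_
      rw [Function.update_of_ne (Finset.ne_of_mem_erase hj)]
  have h2 : tensorBump (s + Pi.single i 1) (fun j => m * x j - b j)
      = iteratedDeriv (s i + 1) unitBump (m * x i - b i)
        * ∏ j ∈ Finset.univ.erase i, iteratedDeriv (s j) unitBump (m * x j - b j) := by
    rw [tensorBump, ← Finset.mul_prod_erase _ _ (Finset.mem_univ i)]
    congr 1
    · simp
    · refine Finset.prod_congr rfl fun j hj => ?_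
      simp [Pi.single_eq_of_ne (Finset.ne_of_mem_erase hj)]
  simp only [h1]
  rw [h2, ← mul_assoc]
  refine HasDerivAt.mul_const ?_ _
  have h3 : HasDerivAt (iteratedDeriv (s i) unitBump)
      (iteratedDeriv (s i + 1) unitBump (m * x i - b i)) (m * x i - b i) := by
    rw [iteratedDeriv_succ]
    exact ((contDiff_iteratedDeriv_unitBump (s i) (r := 1)).differentiable one_ne_zero _).hasDerivAt
  have h4 : HasDerivAt (fun t : ℝ => m * t - b i) m (x i) := by
    simpa using ((hasDerivAt_id (x i)).const_mul (m : ℝ)).sub_const (b i)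
  rw [mul_comm]
  exact h3.comp (x i) h4

/-- Differentiation raises one entry of `s` and brings out a factor `m`, so the family is closed
under it. Equality on the cube suffices as input because `derivWithin` sees only the segment inside
the cube; this permits iteration. -/
theorem cubePartial_eqOn_bumpSum {d m : ℕ} (c : (Fin d → Fin m) → ℝ) (s : Fin d → ℕ) (A : ℝ)
    (g : (Fin d → ℝ) → ℝ) (hg : Set.EqOn g (fun x => A * bumpSum m c s x) (unitCube d))
    (i : Fin d) :
    Set.EqOn (cubePartial i g) (fun x => A * m * bumpSum m c (s + Pi.single i 1) x)
      (unitCube d) := by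
  intro x hx
  have hxi : x i ∈ Set.Icc (0 : ℝ) 1 := ⟨hx.1 i, hx.2 i⟩
  have hup : ∀ t ∈ Set.Icc (0 : ℝ) 1, Function.update x i t ∈ unitCube d := by
    intro t ht
    constructor <;> intro j <;> by_cases hj : j = i
    · subst hj; simpa using ht.1
    · simpa [hj] using hx.1 j
    · subst hj; simpa using ht.2
    · simpa [hj] using hx.2 j
  have h1 : HasDerivAt (fun t : ℝ => A * bumpSum m c s (Function.update x i t))
      (A * ∑ k : Fin d → Fin m, c k * (m * tensorBump (s + Pi.single i 1)
        (fun j => m * x j - (k j : ℕ)))) (x i) := by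
    refine HasDerivAt.const_mul A ?_
    unfold bumpSum
    exact HasDerivAt.fun_sum fun k _ => (hasDerivAt_tensorBump_update m s x _ i).const_mul (c k)
  rw [cubePartial, derivWithin_congr (fun t ht => hg (hup t ht)) (hg (hup _ hxi)),
    h1.hasDerivWithinAt.derivWithin (uniqueDiffOn_Icc zero_lt_one _ hxi)]
  simp only [bumpSum]
  rw [mul_assoc, Finset.mul_sum (a := (m : ℝ))]
  congr 1
  exact Finset.sum_congr rfl fun k _ => by ring

theorem iterate_cubePartial_eqOn_bumpSum {d m : ℕ} (c : (Fin d → Fin m) → ℝ) (i : Fin d)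
    (n : ℕ) (s : Fin d → ℕ) (A : ℝ) (g : (Fin d → ℝ) → ℝ)
    (hg : Set.EqOn g (fun x => A * bumpSum m c s x) (unitCube d)) :
    Set.EqOn ((cubePartial i)^[n] g) (fun x => A * m ^ n * bumpSum m c (s + Pi.single i n) x)
      (unitCube d) := by
  induction n with
  | zero => simpa using hg
  | succ n ih =>
    rw [Function.iterate_succ_apply']
    have := cubePartial_eqOn_bumpSum c _ _ _ ih i
    rw [add_assoc, ← Pi.single_add] at this
    rw [pow_succ, ← mul_assoc]
    exact this

theorem cubeMixedPartial_eqOn_bumpSum {d m : ℕ} (c : (Fin d → Fin m) → ℝ) (α : Fin d → ℕ) :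
    Set.EqOn (cubeMixedPartial α (bumpSum m c 0))
      (fun x => (m : ℝ) ^ (∑ i, α i) * bumpSum m c α x) (unitCube d) := by
  have key : ∀ l : List (Fin d), Set.EqOn
      (l.foldr (fun i h => (cubePartial i)^[α i] h) (bumpSum m c 0))
      (fun x => (m : ℝ) ^ (l.map α).sum
        * bumpSum m c (l.map fun i => Pi.single i (α i)).sum x) (unitCube d) := by
    intro l
    induction l with
    | nil => intro x _; simp
    | cons i l ih =>
      have := iterate_cubePartial_eqOn_bumpSum c i (α i) _ _ _ ih
      simp only [List.foldr_cons, List.map_cons, List.sum_cons]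
      rw [add_comm (α i), pow_add, add_comm (Pi.single (M := fun _ => ℕ) i (α i))]
      exact this
  have h := key (List.finRange d)
  rw [← Fin.sum_univ_def, ← Fin.sum_univ_def, Finset.univ_sum_single] at h
  exact h

theorem contDiff_bumpSum {d m : ℕ} (c : (Fin d → Fin m) → ℝ) (s : Fin d → ℕ) {r : ℕ∞} :
    ContDiff ℝ r (bumpSum m c s) := by
  unfold bumpSum
  refine ContDiff.sum fun k _ => contDiff_const.mul ((contDiff_tensorBump s).comp ?_)
  exact contDiff_pi.2 fun j => (contDiff_const.mul (contDiff_apply ℝ ℝ j)).sub contDiff_const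

/-! ### Bump sums in the Hölder class -/

theorem HolderClass.mono {d : ℕ} {β L L' : ℝ} {f : (Fin d → ℝ) → ℝ} (h : HolderClass d β L f)
    (hL : L ≤ L') : HolderClass d β L' f :=
  ⟨h.1, fun x hx x' hx' => (h.2 x hx x' hx').trans hL⟩

/-- Bump sums with coefficients of size at most `a m^{-β}` lie in a Hölder ball of radius
proportional to `a`. -/
theorem exists_holderClass_bumpSum (d : ℕ) {β : ℝ} (hβ : 0 < β) :
    ∃ S : ℝ, 0 < S ∧ ∀ (m : ℕ) (a : ℝ) (c : (Fin d → Fin m) → ℝ), 1 ≤ m → 0 ≤ a →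
      (∀ k, |c k| ≤ a * (m : ℝ) ^ (-β)) → HolderClass d β (a * S) (bumpSum m c 0) := by
  choose K hK0 hKb hKh using fun s : Fin d → ℕ => exists_tensorBump_holder s
  set ℓ := ⌊β⌋₊ with hℓ
  have hℓβ : (ℓ : ℝ) ≤ β := Nat.floor_le hβ.le
  have hβℓ : β < ℓ + 1 := Nat.lt_floor_add_one β
  -- The final `+ 1` only secures that the constant is positive.
  refine ⟨∑ j ∈ Finset.range (ℓ + 1),
      ∑ α ∈ Finset.piAntidiag (Finset.univ : Finset (Fin d)) j, K α
    + ∑ α ∈ Finset.piAntidiag (Finset.univ : Finset (Fin d)) ℓ, 4 * K α + 1, ?_, ?_⟩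
  · have h1 : 0 ≤ ∑ j ∈ Finset.range (ℓ + 1),
      ∑ α ∈ Finset.piAntidiag (Finset.univ : Finset (Fin d)) j, K α :=
      Finset.sum_nonneg fun j _ => Finset.sum_nonneg fun α _ => hK0 α
    have h2 : 0 ≤ ∑ α ∈ Finset.piAntidiag (Finset.univ : Finset (Fin d)) ℓ, 4 * K α :=
      Finset.sum_nonneg fun α _ => by linarith [hK0 α]
    linarith
  intro m a c hm ha hc
  have hm1 : (1 : ℝ) ≤ m := by exact_mod_cast hm
  have hm0 : (0 : ℝ) < m := by linarith
  have hτ : 0 ≤ a * (m : ℝ) ^ (-β) := by positivity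
  refine ⟨(contDiff_bumpSum c 0 (r := (ℓ : ℕ∞))).contDiffOn, fun x hx x' hx' => ?_⟩
  have hA : ∑ j ∈ Finset.range (ℓ + 1),
        ∑ α ∈ Finset.piAntidiag (Finset.univ : Finset (Fin d)) j,
          |cubeMixedPartial α (bumpSum m c 0) x|
      ≤ a * ∑ j ∈ Finset.range (ℓ + 1),
      ∑ α ∈ Finset.piAntidiag (Finset.univ : Finset (Fin d)) j, K α := by
    rw [Finset.mul_sum]
    refine Finset.sum_le_sum fun j hj => ?_
    rw [Finset.mul_sum]
    refine Finset.sum_le_sum fun α hα => ?_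
    have hαj : ∑ i, α i = j := (Finset.mem_piAntidiag.1 hα).1
    have hjℓ : (j : ℝ) ≤ β := by
      have : j ≤ ℓ := Nat.lt_succ_iff.1 (Finset.mem_range.1 hj)
      exact le_trans (by exact_mod_cast this) hℓβ
    rw [cubeMixedPartial_eqOn_bumpSum c α hx, hαj, abs_mul, abs_of_nonneg (by positivity)]
    calc (m : ℝ) ^ j * |bumpSum m c α x|
        ≤ (m : ℝ) ^ j * (a * (m : ℝ) ^ (-β) * K α) := by
          gcongr; exact abs_bumpSum_le hc hτ α (hK0 α) (hKb α) x
      _ = (m : ℝ) ^ ((j : ℝ) - β) * (a * K α) := by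
          rw [sub_eq_add_neg, Real.rpow_add hm0, Real.rpow_natCast]; ring
      _ ≤ 1 * (a * K α) := by
          have := hK0 α
          gcongr
          exact Real.rpow_le_one_of_one_le_of_nonpos hm1 (by linarith)
      _ = a * K α := one_mul _
  have hB : ∑ α ∈ Finset.piAntidiag (Finset.univ : Finset (Fin d)) ℓ,
          |cubeMixedPartial α (bumpSum m c 0) x - cubeMixedPartial α (bumpSum m c 0) x'|
            / ‖x - x'‖ ^ (β - (ℓ : ℝ))
      ≤ a * ∑ α ∈ Finset.piAntidiag (Finset.univ : Finset (Fin d)) ℓ, 4 * K α := by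
    rw [Finset.mul_sum]
    refine Finset.sum_le_sum fun α hα => ?_
    have hαj : ∑ i, α i = ℓ := (Finset.mem_piAntidiag.1 hα).1
    have h0 := hK0 α
    -- This form of the division bound also covers a zero denominator, as may occur at `x = x'`.
    refine div_le_of_le_mul₀ (by positivity) (by positivity) ?_
    rw [cubeMixedPartial_eqOn_bumpSum c α hx, cubeMixedPartial_eqOn_bumpSum c α hx', hαj,
      ← mul_sub, abs_mul, abs_of_nonneg (by positivity)]
    calc (m : ℝ) ^ ℓ * |bumpSum m c α x - bumpSum m c α x'|
        ≤ (m : ℝ) ^ ℓ * (a * (m : ℝ) ^ (-β) * (4 * K α) * (m * ‖x - x'‖) ^ (β - (ℓ : ℝ))) := by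
          gcongr
          exact abs_bumpSum_sub_le hc hτ α (hK0 α)
            (hKh α _ (by linarith) (by linarith)) x x'
      -- The powers of `m` from differentiation, amplitude and rescaling cancel exactly: `ℓ - β + (β
      -- - ℓ) = 0`.
      _ = ((m : ℝ) ^ (ℓ : ℝ) * (m : ℝ) ^ (-β) * (m : ℝ) ^ (β - (ℓ : ℝ)))
            * (a * (4 * K α) * ‖x - x'‖ ^ (β - (ℓ : ℝ))) := by
          rw [Real.mul_rpow hm0.le (norm_nonneg _), Real.rpow_natCast]; ring
      _ = a * (4 * K α) * ‖x - x'‖ ^ (β - (ℓ : ℝ)) := by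
          rw [← Real.rpow_add hm0, ← Real.rpow_add hm0,
            show (ℓ : ℝ) + -β + (β - ℓ) = 0 by ring, Real.rpow_zero, one_mul]
  rw [mul_add, mul_add]
  linarith

/-! ### Cell cores, where the bumps are constant -/

theorem unitBump_eq_one {t : ℝ} (h : t ∈ Set.Icc (3 / 8 : ℝ) (5 / 8)) : unitBump t = 1 := by
  refine unitBump.one_of_mem_closedBall ?_
  rw [Real.closedBall_eq_Icc]
  simp only [unitBump]
  norm_num
  norm_num at h
  exact h

theorem tensorBump_zero_nonneg {d : ℕ} (u : Fin d → ℝ) : 0 ≤ tensorBump 0 u :=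
  Finset.prod_nonneg fun j _ => by simpa using unitBump.nonneg

theorem tensorBump_zero_le_one {d : ℕ} (u : Fin d → ℝ) : tensorBump 0 u ≤ 1 :=
  Finset.prod_le_one (fun j _ => by simpa using unitBump.nonneg)
    fun j _ => by simpa using unitBump.le_one

theorem sum_tensorBump_sq_le_one {d : ℕ} (m : ℕ) (x : Fin d → ℝ) :
    ∑ k : Fin d → Fin m, tensorBump 0 (fun j => m * x j - (k j : ℕ)) ^ 2 ≤ 1 := by
  classical
  have := sum_le_of_card_support_le
    (fun k : Fin d → Fin m => tensorBump 0 (fun j => m * x j - (k j : ℕ)) ^ 2) _ 1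
    (card_tensorBump_ne_zero_le_one m 0 x) (fun k hk => ?_) (D := 1) zero_le_one
    fun k => pow_le_one₀ (tensorBump_zero_nonneg _) (tensorBump_zero_le_one _)
  · simpa using this
  · simp only [Finset.mem_filter, Finset.mem_univ, true_and, not_not] at hk
    simp [hk]

/-- The subcube of the cell `k` on which its bump is equal to `1`. -/
def cellCore {d m : ℕ} (k : Fin d → Fin m) : Set (Fin d → ℝ) :=
  Set.Icc (fun j => ((k j : ℕ) + 3 / 8) / (m : ℝ)) (fun j => ((k j : ℕ) + 5 / 8) / (m : ℝ))

theorem mem_cellCore {d m : ℕ} (hm : 1 ≤ m) {k : Fin d → Fin m} {x : Fin d → ℝ} :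
    x ∈ cellCore k ↔ ∀ j, m * x j - (k j : ℕ) ∈ Set.Icc (3 / 8 : ℝ) (5 / 8) := by
  have hm0 : (0 : ℝ) < m := by exact_mod_cast hm
  simp only [cellCore, Set.mem_Icc, Pi.le_def, div_le_iff₀ hm0, le_div_iff₀ hm0, ← forall_and]
  refine forall_congr' fun j => ?_
  constructor <;> rintro ⟨h1, h2⟩ <;> constructor <;> linarith

theorem tensorBump_eq_one_of_mem_cellCore {d m : ℕ} (hm : 1 ≤ m) {k : Fin d → Fin m}
    {x : Fin d → ℝ} (hx : x ∈ cellCore k) :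
    tensorBump 0 (fun j => m * x j - (k j : ℕ)) = 1 :=
  Finset.prod_eq_one fun j _ => by simpa using unitBump_eq_one ((mem_cellCore hm).1 hx j)

theorem bumpSum_eq_of_mem_cellCore {d m : ℕ} (hm : 1 ≤ m) (c : (Fin d → Fin m) → ℝ)
    {k : Fin d → Fin m} {x : Fin d → ℝ} (hx : x ∈ cellCore k) : bumpSum m c 0 x = c k := by
  classical
  have h1 := tensorBump_eq_one_of_mem_cellCore hm hx
  rw [bumpSum, Finset.sum_eq_single k, h1, mul_one]
  · intro k' _ hk'
    by_contra h
    refine hk' (Finset.card_le_one.1 (card_tensorBump_ne_zero_le_one m 0 x) _ ?_ _ ?_)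
    · exact Finset.mem_filter.2 ⟨Finset.mem_univ _, right_ne_zero_of_mul h⟩
    · exact Finset.mem_filter.2 ⟨Finset.mem_univ _, by rw [h1]; exact one_ne_zero⟩
  · simp

theorem pairwise_disjoint_cellCore {d m : ℕ} (hm : 1 ≤ m) :
    Pairwise (Function.onFun Disjoint (cellCore : (Fin d → Fin m) → Set (Fin d → ℝ))) := by
  classical
  intro k k' hkk
  refine Set.disjoint_left.2 fun x hx hx' => hkk ?_
  refine Finset.card_le_one.1 (card_tensorBump_ne_zero_le_one m 0 x) _ ?_ _ ?_
  · exact Finset.mem_filter.2 ⟨Finset.mem_univ _,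
      by rw [tensorBump_eq_one_of_mem_cellCore hm hx]; exact one_ne_zero⟩
  · exact Finset.mem_filter.2 ⟨Finset.mem_univ _,
      by rw [tensorBump_eq_one_of_mem_cellCore hm hx']; exact one_ne_zero⟩

theorem cellCore_subset_unitCube {d m : ℕ} (hm : 1 ≤ m) (k : Fin d → Fin m) :
    cellCore k ⊆ unitCube d := by
  have hm0 : (0 : ℝ) < m := by exact_mod_cast hm
  refine Set.Icc_subset_Icc (fun j => ?_) fun j => ?_
  · simp only [Pi.zero_apply]; positivity
  · have h : ((k j : ℕ) : ℝ) + 1 ≤ m := by exact_mod_cast (k j).2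
    simp only [Pi.one_apply]
    rw [div_le_one hm0]
    linarith

theorem volume_cellCore {d m : ℕ} (hm : 1 ≤ m) (k : Fin d → Fin m) :
    volume (cellCore k) = ENNReal.ofReal ((1 / (4 * (m : ℝ))) ^ d) := by
  have hm0 : (0 : ℝ) < m := by exact_mod_cast hm
  have h : ∀ j : Fin d, ((k j : ℕ) + 5 / 8 : ℝ) / m - ((k j : ℕ) + 3 / 8) / m
      = 1 / (4 * (m : ℝ)) := by
    intro j; field_simp; ring
  rw [cellCore, Real.volume_Icc_pi]
  simp only [h, Finset.prod_const, Finset.card_univ, Fintype.card_fin]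
  rw [ENNReal.ofReal_pow (by positivity)]

/-! ### Assouad's lemma -/

/-- Assouad's lemma in probability: if for every bit `k` one of the events `E k false`, `E k true`
always occurs, and flipping the bit `k` changes the law by at most `T k` in total variation, with
`T` at most `3/40` on average, then under some law `P ω` at least a fifth of the events
`E k (ω k)` occur with probability at least `1/4`. -/
theorem exists_assouad {κ Ω : Type*} [Fintype κ] [DecidableEq κ] [Nonempty κ] [MeasurableSpace Ω]
    (P : (κ → Bool) → Measure Ω) [∀ ω, IsProbabilityMeasure (P ω)] (E : κ → Bool → Set Ω)
    (hE : ∀ k b, MeasurableSet (E k b)) (hcov : ∀ k b y, y ∈ E k b ∨ y ∈ E k (!b)) (T : κ → ℝ)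
    (hT : ∀ ω k A, MeasurableSet A →
      |(P (Function.update ω k (!ω k))).real A - (P ω).real A| ≤ T k)
    (hsum : ∑ k, T k ≤ 3 / 40 * Fintype.card κ) :
    ∃ ω, 1 / 4 ≤ (P ω).real
      {y | (Fintype.card κ : ℝ) / 5 ≤ ∑ k, (E k (ω k)).indicator (fun _ => (1 : ℝ)) y} := by
  set M : ℝ := (Fintype.card κ : ℝ) with hM
  have hM0 : 0 < M := by rw [hM]; exact_mod_cast Fintype.card_pos
  have hpair : ∀ ω k, 1 - T k ≤ (P ω).real (E k (ω k))
      + (P (Function.update ω k (!ω k))).real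
        (E k ((Function.update ω k (!ω k) : κ → Bool) k)) := by
    intro ω k
    rw [Function.update_self]
    have h1 := (abs_le.1 (hT ω k _ (hE k (!ω k)))).1
    have h2 : (E k (ω k)) ∪ E k (!ω k) = Set.univ :=
      Set.eq_univ_of_forall fun y => hcov k (ω k) y
    have h3 := measureReal_union_le (μ := P ω) (E k (ω k)) (E k (!ω k))
    rw [h2, probReal_univ] at h3
    linarith
  -- Flipping bit `k` permutes the hypercube, so summing `hpair` over all `ω` counts the same sum
  -- twice.
  have hflip : ∀ k, Function.Involutive fun ω : κ → Bool => Function.update ω k (!ω k) := by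
    intro k ω; simp
  have hk : ∀ k, ∑ ω : κ → Bool, (1 - T k) / 2 ≤ ∑ ω, (P ω).real (E k (ω k)) := by
    intro k
    have h1 := Finset.sum_le_sum fun ω (_ : ω ∈ Finset.univ) => hpair ω k
    have h2 : ∑ ω : κ → Bool, (P (Function.update ω k (!ω k))).real
        (E k ((Function.update ω k (!ω k) : κ → Bool) k)) = ∑ ω, (P ω).real (E k (ω k)) :=
      Equiv.sum_comp (hflip k).toPerm fun ω => (P ω).real (E k (ω k))
    rw [Finset.sum_add_distrib, h2] at h1
    rw [← Finset.sum_div]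
    linarith
  obtain ⟨ω, -, hω⟩ : ∃ ω ∈ Finset.univ, ∑ k, (1 - T k) / 2 ≤ ∑ k, (P ω).real (E k (ω k)) := by
    refine Finset.exists_le_of_sum_le Finset.univ_nonempty ?_
    rw [Finset.sum_comm, Finset.sum_comm (s := Finset.univ (α := κ → Bool))]
    exact Finset.sum_le_sum fun k _ => hk k
  refine ⟨ω, ?_⟩
  set N : Ω → ℝ := fun y => ∑ k, (E k (ω k)).indicator (fun _ => (1 : ℝ)) y with hN
  have hNm : Measurable N :=
    Finset.measurable_fun_sum _ fun k _ => measurable_const.indicator (hE k _)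
  set G : Set Ω := {y | M / 5 ≤ N y} with hG
  have hGm : MeasurableSet G := measurableSet_le measurable_const hNm
  have hint : ∀ k, Integrable ((E k (ω k)).indicator fun _ => (1 : ℝ)) (P ω) := fun k =>
    (integrable_const _).indicator (hE k _)
  have hNint : ∫ y, N y ∂(P ω) = ∑ k, (P ω).real (E k (ω k)) := by
    rw [hN, integral_finsetSum _ fun k _ => hint k]
    exact Finset.sum_congr rfl fun k _ => by rw [integral_indicator_const _ (hE k _)]; simp
  have hGi : Integrable (G.indicator fun _ => M) (P ω) := (integrable_const _).indicator hGm
  -- Reverse Markov inequality: `N` is at most `M` on `G` and below `M / 5` off it. As the mean is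
  -- at least `(1 - 3/40) / 2 * M`, the probability of `G` is at least `37/80 - 1/5 = 21/80 > 1/4`.
  have hle : ∫ y, N y ∂(P ω) ≤ ∫ y, (G.indicator (fun _ => M) y + M / 5) ∂(P ω) := by
    refine integral_mono (integrable_finsetSum _ fun k _ => hint k)
      (hGi.add (integrable_const _)) fun y => ?_
    by_cases hy : y ∈ G
    · have h1 : N y ≤ M := by
        calc N y ≤ ∑ _k : κ, (1 : ℝ) := Finset.sum_le_sum fun k _ =>
              Set.indicator_apply_le' (fun _ => le_rfl) fun _ => zero_le_one
          _ = M := by simp [hM]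
      simp only [Set.indicator_of_mem hy]
      linarith
    · simp only [Set.indicator_of_notMem hy, zero_add]
      exact (not_le.1 hy).le
  rw [hNint, integral_add hGi (integrable_const _), integral_indicator_const _ hGm] at hle
  simp only [integral_const, probReal_univ, smul_eq_mul, one_mul] at hle
  have hs : ∑ k, (1 - T k) / 2 = (M - ∑ k, T k) / 2 := by
    rw [← Finset.sum_div, Finset.sum_sub_distrib]; simp [hM]
  rw [hs] at hω
  have h4 : M * (1 / 4) ≤ M * (P ω).real G := by linarith
  exact le_of_mul_le_mul_left h4 hM0

/-! ### The contamination lower bound -/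

/-- The rate from the contamination: the constants `0` and `λ ε / 2` cannot be told apart. -/
theorem exists_const_of_contamination {d : ℕ} {β lam ε : ℝ} (hl : 0 < lam)
    (hl1 : lam ≤ 1) (hε : 0 < ε) (hε1 : ε < 1) {p : ℕ}
    (fhat : ((Fin d → Fin p) → ℝ) → (Fin d → ℝ) → ℝ) (hf : ∀ y, Measurable (fhat y))
    (hH : ∀ b : ℝ, |b| ≤ lam → HolderClass d β lam fun _ => b) :
    ∃ f : (Fin d → ℝ) → ℝ, HolderClass d β lam f ∧
      ∃ Q : (Fin d → Fin p) → ProbabilityMeasure ℝ,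
        (1 / 4 : ENNReal) ≤ huberLaw f ε Q
          {y | ENNReal.ofReal (lam ^ 2 * ε ^ 2 / 16) ≤ cubeSqDist (fhat y) f} := by
  set a : ℝ := lam * ε / 2 with ha
  have ha0 : 0 < a := by positivity
  have haε : |a| ≤ ε / 2 := by rw [abs_of_pos ha0, ha]; nlinarith
  have hal : |a| ≤ lam := by rw [abs_of_pos ha0, ha]; nlinarith
  obtain ⟨Q, R, hQR⟩ := exists_contamination_eq (gaussianReal 0 1) (gaussianReal a 1) hε hε1
    fun A hA => abs_gaussianReal_sub_le hε hε1 haε hA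
  have hlaw : huberLaw (d := d) (p := p) (fun _ => 0) ε (fun _ => Q)
      = huberLaw (fun _ => a) ε fun _ => R := by
    unfold huberLaw; simp only [hQR]
  have hε' : (0 : ℝ) ≤ 1 - ε := by linarith
  have hprob : IsProbabilityMeasure (huberLaw (d := d) (p := p) (fun _ => 0) ε fun _ => Q) := by
    have : IsProbabilityMeasure (ENNReal.ofReal (1 - ε) • gaussianReal 0 1
        + ENNReal.ofReal ε • (Q : Measure ℝ)) := by
      constructor
      simp [← ENNReal.ofReal_add hε' hε.le]
    unfold huberLaw
    infer_instance
  have hvol : volume (unitCube d) = 1 := by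
    rw [unitCube, Real.volume_Icc_pi]; simp
  have hcov : ({y | ENNReal.ofReal (lam ^ 2 * ε ^ 2 / 16) ≤ cubeSqDist (fhat y) fun _ => 0}
      ∪ {y | ENNReal.ofReal (lam ^ 2 * ε ^ 2 / 16) ≤ cubeSqDist (fhat y) fun _ => a})
      = Set.univ := by
    refine Set.eq_univ_of_forall fun y => ?_
    have h := lintegral_sq_sub_const_ge (unitCube d) a (fhat y) (hf y)
    rw [hvol, mul_one, show a ^ 2 / 4 = lam ^ 2 * ε ^ 2 / 16 by rw [ha]; ring] at h
    exact h
  -- Both failure events are measured under the one common law, and together they cover the whole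
  -- space.
  have hu := measure_union_le (μ := huberLaw (d := d) (p := p) (fun _ => 0) ε fun _ => Q)
    {y | ENNReal.ofReal (lam ^ 2 * ε ^ 2 / 16) ≤ cubeSqDist (fhat y) fun _ => 0}
    {y | ENNReal.ofReal (lam ^ 2 * ε ^ 2 / 16) ≤ cubeSqDist (fhat y) fun _ => a}
  rw [hcov, measure_univ] at hu
  by_contra! hcon
  have h1 := hcon _ (hH 0 (by simpa using hl.le)) fun _ => Q
  have h2 := hcon _ (hH a hal) fun _ => R
  rw [← hlaw] at h2
  have h3 := hu.trans_lt (ENNReal.add_lt_add h1 h2)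
  have h4 : (1 / 4 + 1 / 4 : ENNReal) ≤ 1 := by
    rw [← ENNReal.toReal_le_toReal (by simp) (by simp), ENNReal.toReal_add (by simp) (by simp)]
    norm_num
  exact absurd h3 (not_lt.2 h4)

/-! ### Constants in the Hölder class -/

theorem cubePartial_const {d : ℕ} (i : Fin d) (g : (Fin d → ℝ) → ℝ) (b : ℝ)
    (hg : g = fun _ => b) : cubePartial i g = fun _ => 0 := by
  subst hg; ext x; simp [cubePartial]

theorem iterate_cubePartial_const {d : ℕ} (i : Fin d) (n : ℕ) (b : ℝ) :
    (cubePartial i)^[n] (fun _ => b) = fun _ => if n = 0 then b else 0 := by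
  induction n with
  | zero => simp
  | succ n ih => rw [Function.iterate_succ_apply', ih, cubePartial_const _ _ _ rfl]; simp

theorem cubeMixedPartial_const {d : ℕ} (α : Fin d → ℕ) (b : ℝ) :
    cubeMixedPartial α (fun _ => b) = fun _ => if α = 0 then b else 0 := by
  have key : ∀ l : List (Fin d), l.foldr (fun i h => (cubePartial i)^[α i] h) (fun _ => b)
      = fun _ => if ∀ i ∈ l, α i = 0 then b else 0 := by
    intro l
    induction l with
    | nil => simp
    | cons i l ih =>
      rw [List.foldr_cons, ih, iterate_cubePartial_const]
      simp only [List.forall_mem_cons, ite_and]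
  rw [cubeMixedPartial, key]
  simp [funext_iff]

theorem holderClass_const {d : ℕ} {β L b : ℝ} (hb : |b| ≤ L) :
    HolderClass d β L fun _ => b := by
  refine ⟨contDiffOn_const, fun x _ x' _ => ?_⟩
  simp only [cubeMixedPartial_const, sub_self, abs_zero, zero_div, Finset.sum_const_zero, add_zero]
  rw [Finset.sum_eq_single 0]
  · simpa using hb
  · intro j _ hj
    refine Finset.sum_eq_zero fun α hα => ?_
    rw [if_neg, abs_zero]
    rintro rfl
    exact hj (by simpa using (Finset.mem_piAntidiag.1 hα).1.symm)
  · simp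

/-! ### The nonparametric lower bound -/

theorem huberLaw_gaussian {d p : ℕ} (f : (Fin d → ℝ) → ℝ) {ε : ℝ} (hε : 0 ≤ ε) (hε1 : ε ≤ 1) :
    huberLaw (p := p) f ε (fun i => ⟨gaussianReal (f (designPoint i)) 1, inferInstance⟩)
      = Measure.pi fun i => gaussianReal (f (designPoint i)) 1 := by
  unfold huberLaw
  congr 1
  ext1 i
  rw [ProbabilityMeasure.coe_mk, ← add_smul, ← ENNReal.ofReal_add (by linarith) hε]
  simp

theorem bumpSum_sub {d m : ℕ} (c c' : (Fin d → Fin m) → ℝ) (k : Fin d → Fin m)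
    (h : ∀ k' ≠ k, c k' = c' k') (x : Fin d → ℝ) :
    bumpSum m c 0 x - bumpSum m c' 0 x
      = (c k - c' k) * tensorBump 0 (fun j => m * x j - (k j : ℕ)) := by
  rw [bumpSum, bumpSum, ← Finset.sum_sub_distrib, Finset.sum_eq_single k]
  · ring
  · intro k' _ hk'
    rw [h k' hk', sub_self]
  · simp

/-- Summing the local squared distances over the cells. -/
theorem sum_indicator_mul_le_cubeSqDist {d m : ℕ} (hm : 1 ≤ m) (c : (Fin d → Fin m) → ℝ)
    (g : (Fin d → ℝ) → ℝ) {v : ℝ} (hv : 0 ≤ v) :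
    ENNReal.ofReal ((∑ k : Fin d → Fin m,
        {k | ENNReal.ofReal v ≤ ∫⁻ x in cellCore k, ENNReal.ofReal (|g x - c k| ^ 2)}.indicator
          (fun _ => (1 : ℝ)) k) * v)
      ≤ cubeSqDist g (bumpSum m c 0) := by
  have h1 : ∑ k : Fin d → Fin m, ∫⁻ x in cellCore k, ENNReal.ofReal (|g x - c k| ^ 2)
      ≤ cubeSqDist g (bumpSum m c 0) := by
    have h2 : ∀ k : Fin d → Fin m, ∫⁻ x in cellCore k, ENNReal.ofReal (|g x - c k| ^ 2)
        = ∫⁻ x in cellCore k, ENNReal.ofReal (|g x - bumpSum m c 0 x| ^ 2) := fun k =>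
      setLIntegral_congr_fun measurableSet_Icc fun x hx => by
        simp only [bumpSum_eq_of_mem_cellCore hm c hx]
    simp only [h2]
    rw [← tsum_fintype (L := .unconditional _),
      ← lintegral_iUnion (s := cellCore) (fun k => measurableSet_Icc)
        (pairwise_disjoint_cellCore hm)]
    exact lintegral_mono_set (Set.iUnion_subset fun k => cellCore_subset_unitCube hm k)
  refine le_trans ?_ h1
  rw [Finset.sum_mul, ENNReal.ofReal_sum_of_nonneg fun k _ =>
    mul_nonneg (Set.indicator_nonneg (fun _ _ => zero_le_one) _) hv]
  refine Finset.sum_le_sum fun k _ => ?_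
  by_cases hk : k ∈ {k : Fin d → Fin m |
      ENNReal.ofReal v ≤ ∫⁻ x in cellCore k, ENNReal.ofReal (|g x - c k| ^ 2)}
  · rw [Set.indicator_of_mem hk, one_mul]; exact hk
  · rw [Set.indicator_of_notMem hk]; simp

/-- The number `m` of cells per axis: of order `n^{1/(2β+d)}`. -/
theorem exists_cells_per_axis (d : ℕ) {β : ℝ} (hβ : 0 < β) {n : ℕ} (hn : 1 ≤ n) :
    ∃ m : ℕ, 1 ≤ m ∧ (n : ℝ) * ((m : ℝ) ^ (-β)) ^ 2 ≤ (m : ℝ) ^ d ∧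
      (2 : ℝ) ^ (-(2 * β)) * (n : ℝ) ^ (-(2 * β) / (2 * β + (d : ℝ))) ≤ ((m : ℝ) ^ (-β)) ^ 2 := by
  set e : ℝ := 2 * β + d with he
  have he0 : 0 < e := by positivity
  have hn1 : (1 : ℝ) ≤ n := by exact_mod_cast hn
  have hn0 : (0 : ℝ) < n := by linarith
  set r : ℝ := (n : ℝ) ^ (1 / e) with hr
  have hr1 : 1 ≤ r := Real.one_le_rpow hn1 (by positivity)
  have hre : r ^ e = n := by
    rw [hr, ← Real.rpow_mul hn0.le, one_div, inv_mul_cancel₀ he0.ne', Real.rpow_one]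
  -- Rounding up gives `n ≤ m ^ e`; since `r ≥ 1`, it at most doubles `r`, whence the factor `2 ^
  -- (-(2 * β))`.
  set m := ⌈r⌉₊ with hm
  have hrm : r ≤ m := Nat.le_ceil r
  have hm2 : (m : ℝ) ≤ 2 * r := by
    have := (Nat.ceil_lt_add_one (by linarith : 0 ≤ r)).le
    linarith
  have hm0 : (0 : ℝ) < m := by linarith
  have hsq : ((m : ℝ) ^ (-β)) ^ 2 = (m : ℝ) ^ (-(2 * β)) := by
    rw [← Real.rpow_natCast, ← Real.rpow_mul hm0.le]; congr 1; push_cast; ring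
  refine ⟨m, by exact_mod_cast hm0, ?_, ?_⟩
  · rw [hsq]
    have h1 : (n : ℝ) ≤ (m : ℝ) ^ e := by
      rw [← hre]; exact Real.rpow_le_rpow (by linarith) hrm he0.le
    calc (n : ℝ) * (m : ℝ) ^ (-(2 * β)) ≤ (m : ℝ) ^ e * (m : ℝ) ^ (-(2 * β)) := by gcongr
      _ = (m : ℝ) ^ d := by
        rw [← Real.rpow_add hm0, he, ← Real.rpow_natCast]; congr 1; ring
  · rw [hsq]
    calc (2 : ℝ) ^ (-(2 * β)) * (n : ℝ) ^ (-(2 * β) / e) = (2 * r) ^ (-(2 * β)) := by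
          rw [Real.mul_rpow (by norm_num) (by linarith), hr, ← Real.rpow_mul hn0.le]
          congr 2; ring
      _ ≤ (m : ℝ) ^ (-(2 * β)) :=
          Real.rpow_le_rpow_of_nonpos hm0 hm2 (by linarith)

theorem measurableSet_le_setLIntegral {d p : ℕ} (fhat : ((Fin d → Fin p) → ℝ) → (Fin d → ℝ) → ℝ)
    (hf : Measurable (Function.uncurry fhat)) (B : Set (Fin d → ℝ)) (a : ℝ) (v : ENNReal) :
    MeasurableSet {y | v ≤ ∫⁻ x in B, ENNReal.ofReal (|fhat y x - a| ^ 2)} := by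
  refine measurableSet_le measurable_const ?_
  refine Measurable.lintegral_prod_right' (f := fun z : ((Fin d → Fin p) → ℝ) × (Fin d → ℝ) =>
    ENNReal.ofReal (|fhat z.1 z.2 - a| ^ 2)) ?_
  have h : Measurable fun z : ((Fin d → Fin p) → ℝ) × (Fin d → ℝ) => fhat z.1 z.2 := hf
  have h2 : Measurable fun z : ((Fin d → Fin p) → ℝ) × (Fin d → ℝ) => |fhat z.1 z.2 - a| :=
    measurable_abs.comp (h.sub_const a)
  exact (h2.pow_const 2).ennreal_ofReal

/-- The nonparametric rate, by Assouad's lemma over sums of bumps on `m^d` cells. -/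
theorem exists_bumpSum_nonparametric (d : ℕ) {β : ℝ} (hβ : 0 < β) :
    ∃ c : ℝ, 0 < c ∧ ∀ lam ε : ℝ, 0 < lam → lam ≤ 1 → 0 < ε → ε < 1 → ∀ p : ℕ, 1 ≤ p →
      ∀ fhat : ((Fin d → Fin p) → ℝ) → (Fin d → ℝ) → ℝ, Measurable (Function.uncurry fhat) →
      ∃ f : (Fin d → ℝ) → ℝ, HolderClass d β lam f ∧
        ∃ Q : (Fin d → Fin p) → ProbabilityMeasure ℝ,
          (1 / 4 : ENNReal) ≤ huberLaw f ε Q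
            {y | ENNReal.ofReal (lam ^ 2 *
                (c * ((p ^ d : ℕ) : ℝ) ^ (-(2 * β) / (2 * β + (d : ℝ)))))
              ≤ cubeSqDist (fhat y) f} := by
  obtain ⟨S, hS, hHolder⟩ := exists_holderClass_bumpSum d hβ
  -- The `S` in the denominator keeps the sums in the Hölder ball; the `20` keeps the total
  -- variation budget.
  set b : ℝ := 1 / (20 + S) with hb
  have hb0 : 0 < b := by positivity
  have hb20 : b ≤ 1 / 20 := by rw [hb]; gcongr; linarith
  have hbS : b * S ≤ 1 := by
    rw [hb, one_div_mul_eq_div, div_le_one (by positivity)]; linarith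
  refine ⟨(1 / 20) * (1 / 4) ^ d * b ^ 2 * 2 ^ (-(2 * β)), by positivity, ?_⟩
  intro lam ε hl hl1 hε hε1 p hp fhat hf
  obtain ⟨m, hm, hm1, hm2⟩ := exists_cells_per_axis d hβ (n := p ^ d) (Nat.one_le_pow _ _ hp)
  have hm0 : (0 : ℝ) < m := by exact_mod_cast hm
  have : NeZero m := ⟨by omega⟩
  set a : ℝ := lam * b with ha
  have ha0 : 0 < a := by positivity
  have ha20 : a ≤ 1 / 20 := by rw [ha]; nlinarith
  set τ : ℝ := a * (m : ℝ) ^ (-β) with hτ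
  have hτ0 : 0 < τ := by positivity
  set c : ((Fin d → Fin m) → Bool) → (Fin d → Fin m) → ℝ := fun ω k => if ω k then τ else 0
    with hc
  have hcτ : ∀ ω k, |c ω k| ≤ a * (m : ℝ) ^ (-β) := by
    intro ω k
    simp only [hc]
    split_ifs
    · rw [abs_of_pos hτ0]
    · rw [abs_zero]; exact hτ0.le
  have hclass : ∀ ω, HolderClass d β lam (bumpSum m (c ω) 0) := fun ω =>
    (hHolder m a (c ω) hm ha0.le (hcτ ω)).mono (by rw [ha]; nlinarith)
  set v : ℝ := τ ^ 2 / 4 * (1 / (4 * (m : ℝ))) ^ d with hv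
  have hv0 : 0 ≤ v := by positivity
  set E : (Fin d → Fin m) → Bool → Set ((Fin d → Fin p) → ℝ) := fun k t =>
    {y | ENNReal.ofReal v
      ≤ ∫⁻ x in cellCore k, ENNReal.ofReal (|fhat y x - (if t then τ else 0)| ^ 2)} with hE
  have hfy : ∀ y, Measurable (fhat y) := fun y => hf.comp measurable_prodMk_left
  have hcov : ∀ k t y, y ∈ E k t ∨ y ∈ E k (!t) := by
    intro k t y
    have h := lintegral_sq_sub_const_ge (cellCore k) τ (fhat y) (hfy y)
    rw [volume_cellCore hm, ← ENNReal.ofReal_mul (by positivity)] at h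
    cases t
    · exact h
    · exact h.symm
  -- Flipping bit `k` shifts the mean at each design point by `τ` times the value of bump `k` there,
  -- up to sign.
  set T : (Fin d → Fin m) → ℝ := fun k => 1 / 20 + 10 * ∑ i : Fin d → Fin p,
    τ ^ 2 * tensorBump 0 (fun j => m * designPoint i j - (k j : ℕ)) ^ 2 with hT
  have hcard : (Fintype.card (Fin d → Fin m) : ℝ) = (m : ℝ) ^ d := by simp
  obtain ⟨ω, hω⟩ := exists_assouad
    (fun ω => Measure.pi fun i : Fin d → Fin p =>
      gaussianReal (bumpSum m (c ω) 0 (designPoint i)) 1) E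
    (fun k t => measurableSet_le_setLIntegral fhat hf _ _ _) hcov T
    (fun ω k A hA => by
      refine (abs_pi_gaussianReal_sub_le _ _ hA).trans (le_of_eq ?_)
      simp only [hT]
      congr 2
      refine Finset.sum_congr rfl fun i _ => ?_
      rw [bumpSum_sub _ _ k (fun k' hk' => by simp [hc, Function.update_of_ne hk']), mul_pow]
      congr 1
      simp only [hc, Function.update_self]
      cases ω k <;> simp)
    (by
      -- Disjoint supports bound the double sum by `n * τ ^ 2 ≤ a ^ 2 * m ^ d`. With `a ≤ 1 / 20`
      -- the average of `T` is at most `1/20 + 10/400 = 3/40`.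
      have h1 : ∑ k, ∑ i : Fin d → Fin p,
          τ ^ 2 * tensorBump 0 (fun j => m * designPoint i j - ((k : Fin d → Fin m) j : ℕ)) ^ 2
          ≤ a ^ 2 * (m : ℝ) ^ d := by
        rw [Finset.sum_comm]
        calc _ ≤ ∑ _i : Fin d → Fin p, τ ^ 2 := Finset.sum_le_sum fun i _ => by
              rw [← Finset.mul_sum]
              exact mul_le_of_le_one_right (sq_nonneg _) (sum_tensorBump_sq_le_one m _)
          _ = a ^ 2 * (((p ^ d : ℕ) : ℝ) * ((m : ℝ) ^ (-β)) ^ 2) := by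
              simp [hτ]; ring
          _ ≤ a ^ 2 * (m : ℝ) ^ d := by gcongr
      have h2 : a ^ 2 * (m : ℝ) ^ d ≤ (1 / 20) ^ 2 * (m : ℝ) ^ d := by gcongr
      have h3 : ∑ k, T k = (m : ℝ) ^ d * (1 / 20) + 10 * ∑ k, ∑ i : Fin d → Fin p,
          τ ^ 2 * tensorBump 0
            (fun j => m * designPoint i j - ((k : Fin d → Fin m) j : ℕ)) ^ 2 := by
        simp only [hT]
        rw [Finset.sum_add_distrib, ← Finset.mul_sum]
        simp
      rw [h3, hcard]
      linarith)
  refine ⟨_, hclass ω,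
    fun i => ⟨gaussianReal (bumpSum m (c ω) 0 (designPoint i)) 1, inferInstance⟩, ?_⟩
  rw [huberLaw_gaussian _ hε.le hε1.le]
  have hq : (1 / 4 : ENNReal) = ENNReal.ofReal (1 / 4) := by
    rw [ENNReal.ofReal_div_of_pos (by norm_num)]; simp
  rw [hq]
  refine (ENNReal.ofReal_le_of_le_toReal hω).trans (measure_mono fun y hy => ?_)
  rw [Set.mem_ofPred_eq, hcard] at hy
  refine le_trans (ENNReal.ofReal_le_ofReal ?_)
    (sum_indicator_mul_le_cubeSqDist hm (c ω) (fhat y) hv0)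
  have h1 : (m : ℝ) ^ d / 5 * v = 1 / 20 * (1 / 4) ^ d * a ^ 2 * ((m : ℝ) ^ (-β)) ^ 2 := by
    rw [hv, hτ, one_div_pow, mul_pow 4 (m : ℝ), one_div_pow]
    field_simp
    norm_num
  calc lam ^ 2 * (1 / 20 * (1 / 4) ^ d * b ^ 2 * 2 ^ (-(2 * β))
        * ((p ^ d : ℕ) : ℝ) ^ (-(2 * β) / (2 * β + (d : ℝ))))
      = 1 / 20 * (1 / 4) ^ d * a ^ 2 * (2 ^ (-(2 * β))
        * ((p ^ d : ℕ) : ℝ) ^ (-(2 * β) / (2 * β + (d : ℝ)))) := by rw [ha]; ring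
    _ ≤ 1 / 20 * (1 / 4) ^ d * a ^ 2 * ((m : ℝ) ^ (-β)) ^ 2 := by gcongr
    _ = (m : ℝ) ^ d / 5 * v := h1.symm
    _ ≤ _ := by
      gcongr
      exact hy

/-! ### Combination of the two bounds -/

theorem mainTheorem5 :
    ∃ C : ℝ → ℝ, (∀ L₀ : ℝ, 0 < L₀ → 0 < C L₀) ∧
      ∀ d : ℕ, 1 ≤ d → ∀ β : ℝ, 0 < β →
        ∃ P : Polynomial ℝ, P ≠ 0 ∧ (∀ L : ℝ, 0 < L → 0 < P.eval L) ∧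
          ∀ L₀ L ε : ℝ, 0 < L₀ → L₀ ≤ L → ε ∈ Set.Ioo (0 : ℝ) 1 →
            ∀ p : ℕ, 1 ≤ p →
              ∀ fhat : ((Fin d → Fin p) → ℝ) → (Fin d → ℝ) → ℝ,
                Measurable (Function.uncurry fhat) →
                ∃ f : (Fin d → ℝ) → ℝ, HolderClass d β L f ∧
                  ∃ Q : (Fin d → Fin p) → ProbabilityMeasure ℝ,
                    (1 / 4 : ENNReal) ≤
                      huberLaw f ε Q
                        {y | ENNReal.ofReal
                              (C L₀ * (P.eval L
                                * ((p ^ d : ℕ) : ℝ) ^ (-(2 * β) / (2 * β + (d : ℝ))) + ε ^ 2))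
                            ≤ cubeSqDist (fhat y) f} := by
  refine ⟨fun L₀ => (min 1 L₀) ^ 2 / 32, fun L₀ h => by positivity, fun d _ β hβ => ?_⟩
  obtain ⟨c, hc, hnon⟩ := exists_bumpSum_nonparametric d hβ
  -- The factor `16` balances the bounds `lam ^ 2 * c * r` and `lam ^ 2 * ε ^ 2 / 16`; half their
  -- common scale gives `lam ^ 2 / 32`, free of `d` and `β`.
  refine ⟨Polynomial.C (16 * c), by simpa using hc.ne', fun L _ => by simpa using hc, ?_⟩
  intro L₀ L ε hL₀ hL hε p hp fhat hf
  set lam : ℝ := min 1 L₀ with hlam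
  have hl : 0 < lam := by positivity
  have hl1 : lam ≤ 1 := min_le_left _ _
  have hlL : lam ≤ L := (min_le_right _ _).trans hL
  set r : ℝ := ((p ^ d : ℕ) : ℝ) ^ (-(2 * β) / (2 * β + (d : ℝ))) with hr
  simp only [Polynomial.eval_C]
  rcases le_total (ε ^ 2) (16 * c * r) with h | h
  · obtain ⟨f, hf1, Q, hQ⟩ := hnon lam ε hl hl1 hε.1 hε.2 p hp fhat hf
    refine ⟨f, hf1.mono hlL, Q, hQ.trans (measure_mono fun y hy => ?_)⟩
    rw [Set.mem_ofPred_eq] at hy ⊢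
    refine (ENNReal.ofReal_le_ofReal ?_).trans hy
    calc lam ^ 2 / 32 * (16 * c * r + ε ^ 2) ≤ lam ^ 2 / 32 * (16 * c * r + 16 * c * r) := by
          gcongr
      _ = lam ^ 2 * (c * r) := by ring
  · obtain ⟨f, hf1, Q, hQ⟩ := exists_const_of_contamination (β := β) hl hl1 hε.1 hε.2 fhat
      (fun y => hf.comp measurable_prodMk_left) fun b hb => holderClass_const hb
    refine ⟨f, hf1.mono hlL, Q, hQ.trans (measure_mono fun y hy => ?_)⟩
    rw [Set.mem_ofPred_eq] at hy ⊢
    refine (ENNReal.ofReal_le_ofReal ?_).trans hy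
    calc lam ^ 2 / 32 * (16 * c * r + ε ^ 2) ≤ lam ^ 2 / 32 * (ε ^ 2 + ε ^ 2) := by gcongr
      _ = lam ^ 2 * ε ^ 2 / 16 := by ring
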